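/- Let $d\ge 0$, let $S$ be a finite set, $\Omega=S^{\mathbb Z^{d+1}}$ with the product $\sigma$-algebra, $(\tau_x\sigma)(y)=\sigma(x+y)$, and $\Lambda_n=\{-n,\dots,n\}^{d+1}$, $n\ge 0$. Transformations. For each $n$ let $\pi_n:\Omega\to\Omega$ satisfy: (1) $\pi_n(\sigma)(x)=\sigma(x)$ for $x\notin\Lambda_n$, and $\pi_n(\sigma)|_{\Lambda_n}$ depends only on $\sigma|_{\Lambda_n}$; (2) $\pi_n\circ\pi_n=1$; (3) for every $x\in\mathbb Z^{d+1}$ there is $x'\in\mathbb Z^{d+1}$ with $\pi_n(\tau_x\sigma)(y)=\pi_n(\sigma)(y+x')$ for all $n$, all $\sigma\in\Omega$ and all $y$ with $y,\,y+x'\in\Lambda_n$; (4) $\pi_n(\sigma)(x)=\pi_k(\sigma)(x)$ for $x\in\Lambda_n$, $n\le k$. (Spin flip, with $x'=x$, and time reversal, with $x'$ the reflected $x$, are examples.) Write $\pi_nf=f\circ\pi_n$, and for a finite set $A\subset\mathbb Z^{d+1}$ let $n(A)$ be the least $n$ with $A\subset\Lambda_n$. Potentials. Let $U^0,U^1,\dots,U^m$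 be potentials: for each finite $A$, $U^\alpha_A:\Omega\to\mathbb R$ depends only on the spins in $A$, $U^\alpha_\emptyset=0$, $U^\alpha_{A+x}(\sigma)=U^\alpha_A(\tau_x\sigma)$, and $\sum_{A\ni 0}\|U^\alpha_A\|_\infty<\infty$. Suppose that $\pi_nU^0_A=U^0_A$ whenever $n\ge n(A)$. (No invariance is assumed for $U^1,\dots,U^m$.) For $\alpha=1,\dots,m$ define the currents $$J^\alpha_x=\lim_{n}\sum_{x\in A\subset\Lambda_n}\frac1{2|A|}\bigl(\pi_{n(A)}U^\alpha_A-U^\alpha_A\bigr).$$ Let $\beta\in\mathbb R$. For $E=(E^1,\dots,E^m)\in\mathbb R^m$ put $U^E_A=U^0_A+\sum_{\alpha=1}^mE^\alpha U^\alpha_A$. A probability measure $\mu$ on $\Omega$ is a Gibbs state for $U^E$ at inverse temperature $\beta$ if for all finite $\Lambda$ and all $\sigma,\eta\in S^\Lambda$, for $\mu$-almost every $\xi$, $$\frac{\mu[X=\sigma\text{ on }\Lambda\mid X=\xi\text{ on }\Lambda^c]}{\mu[X=\eta\text{ on }\Lambda\mid X=\xi\text{ on }\Lambda^c]}=\exp\Bigl[-\beta\sum_A\bigl(U^E_A(\sigma\xi_{\Lambda^c})-U^E_A(\eta\xi_{\Lambda^c})\bigr)\Bigr].$$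 Theorem. The limits defining the currents $J^\alpha_x$ exist, uniformly on $\Omega$. There is a function $p:\mathbb R^m\times\mathbb R^m\to\mathbb R$ such that for every $E\in\mathbb R^m$, every translation-invariant Gibbs state $\mu$ for $U^E$ at inverse temperature $\beta$ and every $\lambda\in\mathbb R^m$ the following limit exists and equals $p(\lambda,E)$: $$p(\lambda,E)=-\lim_{n\to\infty}\frac1{|\Lambda_n|}\ln\mu\Bigl[\exp\Bigl(-\beta\sum_{x\in\Lambda_n}\sum_{\alpha=1}^m\lambda_\alpha J^\alpha_x\Bigr)\Bigr].$$ It satisfies $p(\lambda,E)=p(2E-\lambda,E)$ for all $\lambda,E\in\mathbb R^m$. -/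

import Mathlib

open Filter Topology MeasureTheory

noncomputable section

namespace LatticeGibbs

/-- The space-time lattice `ℤ^{d+1}`. -/
abbrev Site (d : ℕ) : Type := Fin (d + 1) → ℤ

/-- Configurations `σ : ℤ^{d+1} → S`, with the product σ-algebra. -/
abbrev Config (d : ℕ) (S : Type*) : Type _ := Site d → S

variable {d : ℕ} {S : Type*}

/-- The translation `(τ_x σ)(y) = σ (y + x)`. -/
def shift (x : Site d) (σ : Config d S) : Config d S := fun y => σ (y + x)

/-- The translated region `A + x`. -/
def translate (A : Finset (Site d)) (x : Site d) : Finset (Site d) :=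
  A.map (addRightEmbedding x)

/-- The cube `Λ_n = {-n, …, n}^{d+1}` centered at the origin. -/
def box (d n : ℕ) : Finset (Site d) := Finset.Icc (fun _ => -(n : ℤ)) (fun _ => (n : ℤ))

/-- `n(A)`: the index of the smallest centered cube that contains `A`. -/
def boxIndex (A : Finset (Site d)) : ℕ := sInf {n : ℕ | A ⊆ box d n}

/-- A family `π n` of local involutions, `π n` acting in the cube `Λ_n`. -/
structure IsLocalInvolutionFamily (π : ℕ → Config d S → Config d S) : Prop where
  /-- `π n` leaves the spins outside `Λ_n` unchanged. -/
  apply_of_notMem : ∀ n σ, ∀ x ∉ box d n, π n σ x = σ x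
  /-- `π n` is (induced by) a transformation of `S^{Λ_n}`. -/
  congr_on_box : ∀ n σ η, (∀ x ∈ box d n, σ x = η x) → ∀ x ∈ box d n, π n σ x = π n η x
  /-- `π n ∘ π n = 1`. -/
  involutive : ∀ n, Function.Involutive (π n)
  /-- `π n` and `π k` agree on the smaller of the two cubes. -/
  consistent : ∀ n k, n ≤ k → ∀ σ, ∀ x ∈ box d n, π n σ x = π k σ x
  /-- The transformations carry translations to translations: for each `x` there is an `x'` with
  `π ∘ τ_x = τ_{x'} ∘ π` wherever both sides are seen inside the cube (`x' = x` for a spin flip,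
  `x'` the time-reflected `x` for time reversal). -/
  covariant : ∀ x : Site d, ∃ x' : Site d, ∀ n σ y, y ∈ box d n → y + x' ∈ box d n →
    π n (shift x σ) y = shift x' (π n σ) y

/-- A (family of functions `U_A` forming a) translation-invariant, uniformly absolutely summable
interaction potential. -/
structure IsPotential (U : Finset (Site d) → Config d S → ℝ) : Prop where
  empty : ∀ σ, U ∅ σ = 0
  /-- `U_A` depends only on the spins in `A`. -/
  congr_on : ∀ A σ η, (∀ x ∈ A, σ x = η x) → U A σ = U A η
  /-- `U_{A+x} = τ_x U_A`. -/
  translation : ∀ A x σ, U (translate A x) σ = U A (shift x σ)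
  /-- `∑_{A ∋ 0} ‖U_A‖ < ∞` for the uniform norm. -/
  summable : Summable fun A : {A : Finset (Site d) // (0 : Site d) ∈ A} => ⨆ σ, |U A.1 σ|

/-- `U_A = U⁰_A + ∑_α E^α U^α_A`. -/
def totalPotential {m : ℕ} (U₀ : Finset (Site d) → Config d S → ℝ)
    (U : Fin m → Finset (Site d) → Config d S → ℝ) (E : Fin m → ℝ) :
    Finset (Site d) → Config d S → ℝ :=
  fun A σ => U₀ A σ + ∑ α, E α * U α A σ

/-- The relative energy `H(σ) - H(η)` of configurations that differ at finitely many sites;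
only sets `A` meeting the difference set contribute. -/
def relEnergy (U : Finset (Site d) → Config d S → ℝ) (σ η : Config d S) : ℝ :=
  ∑' A, (U A σ - U A η)

/-- `μ[X(x) = σ(x), x ∈ Λ | X = ξ off Λ]` as a function of `ξ`: the conditional probability given
the spins outside `Λ`. -/
def localCondProb [MeasurableSpace S] (μ : Measure (Config d S)) (Λ : Finset (Site d))
    (σ : Config d S) : Config d S → ℝ :=
  μ[Set.indicator {ω : Config d S | ∀ x ∈ Λ, ω x = σ x} (fun _ => (1 : ℝ)) |
    cylinderEvents (X := fun _ : Site d => S) ((Λ : Set (Site d))ᶜ)]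

/-- `μ` is a Gibbs state for `U` at inverse temperature `β`: the ratio of the conditional
probabilities of two configurations in `Λ` is the Boltzmann factor of their relative energy. -/
def IsGibbs [MeasurableSpace S] (β : ℝ) (U : Finset (Site d) → Config d S → ℝ)
    (μ : Measure (Config d S)) : Prop :=
  ∀ (Λ : Finset (Site d)) (σ η : Config d S), ∀ᵐ ξ ∂μ,
    localCondProb μ Λ σ ξ / localCondProb μ Λ η ξ =
      Real.exp (-β * relEnergy U (Λ.piecewise σ ξ) (Λ.piecewise η ξ))

/-- `μ` is invariant under all lattice translations. -/
def IsTranslationInvariant [MeasurableSpace S] (μ : Measure (Config d S)) : Prop :=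
  ∀ x : Site d, μ.map (shift x) = μ

/-- `∑_{x ∈ A ⊆ Λ_n} (1 / (2|A|)) (π_{n(A)} U_A - U_A)`. -/
def currentApprox (π : ℕ → Config d S → Config d S) (U : Finset (Site d) → Config d S → ℝ)
    (x : Site d) (n : ℕ) (σ : Config d S) : ℝ :=
  ∑ A ∈ (box d n).powerset with x ∈ A,
    1 / (2 * (A.card : ℝ)) * (U A (π (boxIndex A) σ) - U A σ)

/-- The current `J_x` of the potential `U`: the limit of the finite sums above. -/
def current (π : ℕ → Config d S → Config d S) (U : Finset (Site d) → Config d S → ℝ)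
    (x : Site d) (σ : Config d S) : ℝ :=
  limUnder atTop fun n => currentApprox π U x n σ

end LatticeGibbs

end

noncomputable section

namespace LatticeGibbs

variable {d : ℕ} {S : Type*}

/-! The local involutions are restrictions of one global map `F σ = f ∘ σ ∘ θ`, where `f` is an
involution of `S` and `θ` an additive involution of the lattice that preserves every cube
(`exists_isSiteSymmetry`). Let `e_α` be the energy per site of `U^α`, the sum of `U^α_A / |A|` over
`A ∋ 0`. The current at `x` is `(e_α ∘ τ_x ∘ F - e_α ∘ τ_x) / 2`. Since `θ` permutes `Λ_n`, its sum
over `Λ_n` equals the sum of the translates of the single observable `(e_α ∘ F - e_α) / 2`.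

In a Gibbs state for `U`, the weight of a configuration in `Λ_n` is `exp(-β ∑ e_U ∘ τ_x) / Z` up to
a factor `exp(o(|Λ_n|))`. Hence the logarithmic moment of `∑ G ∘ τ_x` per site tends to `P(-β e_U +
G) - P(-β e_U)`, with `P` the pressure (`IsGibbs.tendsto_log_integral_exp`). This limit does not
depend on the Gibbs state. The pressure exists by subadditivity; partition functions built from
suprema over exterior spins are exactly submultiplicative, with no boundary correction.

For the currents with parameter `λ`, the argument of the first pressure is `-β (e_0 + ∑ (E_α -
λ_α/2) e_α + ∑ (λ_α/2) e_α ∘ F)`. Replacing `λ` by `2E - λ` exchanges the two coefficients, which is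
composition with `F` because `e_0 ∘ F = e_0` and `F ∘ F = 1`. The pressure is invariant under `F`,
and this gives the symmetry. -/

/-! ### Cubes and boundary layers. -/

theorem mem_box {n : ℕ} {x : Site d} : x ∈ box d n ↔ ∀ i, -(n : ℤ) ≤ x i ∧ x i ≤ n := by
  simp [box, Finset.mem_Icc, Pi.le_def, forall_and]

theorem box_mono : Monotone (box d) := fun m n h x hx => by
  rw [mem_box] at hx ⊢
  intro i
  have := hx i
  omega

theorem zero_mem_box (n : ℕ) : (0 : Site d) ∈ box d n := by
  rw [mem_box]; intro i; simp

theorem mem_box_zero {x : Site d} : x ∈ box d 0 ↔ x = 0 := by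
  rw [mem_box, funext_iff]
  refine forall_congr' fun i => ?_
  simp only [Pi.zero_apply]
  omega

theorem card_box (n : ℕ) : (box d n).card = (2 * n + 1) ^ (d + 1) := by
  rw [box, Pi.card_Icc]
  simp only [Int.card_Icc, Finset.prod_const, Finset.card_univ, Fintype.card_fin]
  congr 1
  omega

theorem card_box_pos (n : ℕ) : (0 : ℝ) < (box d n).card := by
  rw [card_box]; positivity

theorem exists_mem_box (x : Site d) : ∃ n, x ∈ box d n := by
  refine ⟨∑ i, (x i).natAbs, ?_⟩
  rw [mem_box]
  intro i
  have : (x i).natAbs ≤ ∑ i, (x i).natAbs :=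
    Finset.single_le_sum (f := fun i => (x i).natAbs) (fun _ _ => Nat.zero_le _)
      (Finset.mem_univ i)
  omega

theorem exists_subset_box (A : Finset (Site d)) : ∃ n, A ⊆ box d n := by
  choose N hN using exists_mem_box (d := d)
  refine ⟨A.sup N, fun x hx => box_mono (Finset.le_sup hx) (hN x)⟩

theorem subset_box_boxIndex (A : Finset (Site d)) : A ⊆ box d (boxIndex A) :=
  Nat.sInf_mem (s := {n : ℕ | A ⊆ box d n}) (exists_subset_box A)

theorem mem_translate {A : Finset (Site d)} {x y : Site d} :
    y ∈ translate A x ↔ y - x ∈ A := by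
  simp only [translate, Finset.mem_map, addRightEmbedding_apply]
  constructor
  · rintro ⟨a, ha, rfl⟩; simpa using ha
  · intro h; exact ⟨y - x, h, by simp⟩

theorem card_translate (A : Finset (Site d)) (x : Site d) : (translate A x).card = A.card :=
  Finset.card_map _

theorem tendsto_card_box_ratio (s : ℕ) :
    Tendsto (fun n : ℕ => ((box d (n - s)).card : ℝ) / (box d n).card) atTop (𝓝 1) := by
  have h1 : Tendsto (fun n : ℕ => (1 : ℝ) - (2 * s) / (2 * (n : ℝ) + 1)) atTop (𝓝 (1 - 0)) := by
    refine tendsto_const_nhds.sub (Tendsto.div_atTop tendsto_const_nhds ?_)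
    exact tendsto_atTop_add_const_right _ _
      (tendsto_natCast_atTop_atTop.const_mul_atTop (by norm_num))
  have h2 := h1.pow (d + 1)
  rw [sub_zero, one_pow] at h2
  refine h2.congr' ?_
  filter_upwards [eventually_ge_atTop s] with n hn
  rw [card_box, card_box]
  push_cast [hn]
  rw [← div_pow]
  congr 1
  field_simp
  ring

/-- Sites within `k` of the boundary are a vanishing fraction of the cube and together cost at most
`ε |Λ_n|`; the interior costs another `ε |Λ_n|`. The threshold on `n` does not depend on `r`, which
makes later estimates uniform in configurations. -/
theorem eventually_sum_box_le {C ε : ℝ} (hε : 0 < ε) (k : ℕ) :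
    ∀ᶠ n in atTop, ∀ r : Site d → ℝ, (∀ x ∈ box d n, r x ≤ C) →
      (∀ x, translate (box d k) x ⊆ box d n → r x ≤ ε) →
        ∑ x ∈ box d n, r x ≤ 2 * ε * (box d n).card := by
  have h := (((tendsto_card_box_ratio (d := d) k).const_sub 1).const_mul C)
  rw [sub_self, mul_zero] at h
  filter_upwards [h.eventually_le_const hε, eventually_ge_atTop k] with n hn hk r hr1 hr2
  have hsub : box d (n - k) ⊆ box d n := box_mono (Nat.sub_le _ _)
  rw [← Finset.sum_sdiff hsub]
  have h1 : ∑ x ∈ box d n \ box d (n - k), r x ≤ C * ((box d n).card - (box d (n - k)).card) := by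
    refine (Finset.sum_le_card_nsmul _ _ C fun x hx => hr1 x (Finset.mem_sdiff.1 hx).1).trans ?_
    rw [nsmul_eq_mul, mul_comm, Finset.card_sdiff_of_subset hsub,
      Nat.cast_sub (Finset.card_le_card hsub)]
  have h2 : ∑ x ∈ box d (n - k), r x ≤ ε * (box d n).card := by
    refine (Finset.sum_le_card_nsmul _ _ ε fun x hx => hr2 x ?_).trans ?_
    · intro y hy
      rw [mem_translate, mem_box] at hy
      rw [mem_box] at hx ⊢
      intro i
      have := hy i
      have := hx i
      simp only [Pi.sub_apply] at *
      omega
    · rw [nsmul_eq_mul, mul_comm]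
      have := Finset.card_le_card hsub
      gcongr
  have hp := card_box_pos (d := d) n
  have h3 : C * ((box d n).card - (box d (n - k)).card) ≤ ε * (box d n).card := by
    have := mul_le_mul_of_nonneg_right hn hp.le
    refine le_trans (le_of_eq ?_) this
    field_simp
  linarith

/-! ### Subadditive functions of regions. -/

/-- A function on finite regions of the lattice that is subadditive on disjoint unions. -/
structure IsSubadditiveOnRegions (q : Finset (Site d) → ℝ) : Prop where
  empty : q ∅ ≤ 0
  union : ∀ A B, Disjoint A B → q (A ∪ B) ≤ q A + q B
  translate : ∀ A x, q (translate A x) = q A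

namespace IsSubadditiveOnRegions

variable {q : Finset (Site d) → ℝ}

theorem biUnion_le {ι : Type*} [DecidableEq ι] (hq : IsSubadditiveOnRegions q) (T : Finset ι)
    (t : ι → Finset (Site d)) (ht : (T : Set ι).PairwiseDisjoint t) :
    q (T.biUnion t) ≤ ∑ i ∈ T, q (t i) := by
  induction T using Finset.induction_on with
  | empty => simpa using hq.empty
  | insert a T ha ih =>
    rw [Finset.biUnion_insert, Finset.sum_insert ha]
    refine (hq.union _ _ ?_).trans (add_le_add le_rfl (ih (ht.subset (by simp))))
    rw [Finset.disjoint_biUnion_right]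
    intro i hi
    exact ht (by simp) (by simp [hi]) (fun h => ha (h ▸ hi))

theorem le_card_mul (hq : IsSubadditiveOnRegions q) (A : Finset (Site d)) :
    q A ≤ A.card * q {0} := by
  have h := hq.biUnion_le A (fun x => {x}) (fun x _ y _ h => by simpa using h)
  rw [Finset.biUnion_singleton_eq_self] at h
  refine h.trans (le_of_eq ?_)
  rw [Finset.sum_congr rfl (g := fun _ => q {0}), Finset.sum_const, nsmul_eq_mul]
  intro x _
  rw [← hq.translate {0} x]
  congr 1
  simp [LatticeGibbs.translate]

/-- Translates of `Λ_k` centred at the points `(2k+1) y`, `y ∈ Λ_a`, tile the cube of index `(2k+1)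
a + k` exactly. The sites of `Λ_N` left over are charged `q {0}` each. -/
theorem box_le (hq : IsSubadditiveOnRegions q) (k a N : ℕ) (hN : (2 * k + 1) * a + k ≤ N) :
    q (box d N) ≤ (box d a).card * q (box d k) +
      ((box d N).card - (box d ((2 * k + 1) * a + k)).card) * q {0} := by
  set t : Site d → Finset (Site d) :=
    fun y => LatticeGibbs.translate (box d k) ((2 * k + 1 : ℤ) • y) with ht
  have hdisj : ((box d a : Finset (Site d)) : Set (Site d)).PairwiseDisjoint t := by
    intro y _ z _ hyz
    rw [Function.onFun, Finset.disjoint_left]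
    intro w hw1 hw2
    apply hyz
    simp only [ht, mem_translate, mem_box] at hw1 hw2
    funext i
    have h1 := hw1 i
    have h2 := hw2 i
    simp only [Pi.sub_apply, Pi.smul_apply, smul_eq_mul] at h1 h2
    rcases lt_trichotomy (y i) (z i) with h | h | h
    · nlinarith
    · exact h
    · nlinarith
  have hsub : (box d a).biUnion t ⊆ box d N := by
    intro w hw
    rw [Finset.mem_biUnion] at hw
    obtain ⟨y, hy, hw⟩ := hw
    simp only [ht, mem_translate] at hw
    rw [mem_box] at hw hy ⊢
    intro i
    have h1 := hw i
    have h2 := hy i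
    simp only [Pi.sub_apply, Pi.smul_apply, smul_eq_mul] at h1
    have hN' : (2 * k + 1 : ℤ) * a + k ≤ N := by exact_mod_cast hN
    constructor <;> nlinarith
  have hcard : ((box d a).biUnion t).card = (box d ((2 * k + 1) * a + k)).card := by
    rw [Finset.card_biUnion hdisj]
    simp only [ht, card_translate, Finset.sum_const, smul_eq_mul]
    rw [card_box, card_box, card_box, ← mul_pow]
    congr 1
    ring
  have h1 := hq.union _ _ (Finset.disjoint_sdiff (s := (box d a).biUnion t) (t := box d N))
  rw [Finset.union_sdiff_of_subset hsub] at h1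
  have h2 := hq.biUnion_le _ _ hdisj
  have h3 := hq.le_card_mul (box d N \ (box d a).biUnion t)
  rw [Finset.card_sdiff_of_subset hsub, Nat.cast_sub (Finset.card_le_card hsub), hcard] at h3
  have h4 : ∑ i ∈ box d a, q (t i) = (box d a).card * q (box d k) := by
    simp only [ht, hq.translate, Finset.sum_const, nsmul_eq_mul]
  linarith

/-- Fekete's lemma along the cubes `Λ_n`. -/
theorem exists_tendsto (hq : IsSubadditiveOnRegions q) {C : ℝ}
    (hC : ∀ A : Finset (Site d), -C * A.card ≤ q A) :
    ∃ L, Tendsto (fun n => q (box d n) / (box d n).card) atTop (𝓝 L) := by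
  have hbdd : BddBelow (Set.range fun n => q (box d n) / (box d n).card) := by
    refine ⟨-C, ?_⟩
    rintro _ ⟨n, rfl⟩
    exact (le_div_iff₀ (card_box_pos n)).2 (hC _)
  -- The limit is the infimum. For the upper bound, larger cubes are tiled by a nearly optimal
  -- `Λ_k`.
  refine ⟨⨅ n, q (box d n) / (box d n).card, tendsto_order.2 ⟨fun a ha => ?_, fun a ha => ?_⟩⟩
  · exact Eventually.of_forall fun n => ha.trans_le (ciInf_le hbdd n)
  obtain ⟨k, hk⟩ := exists_lt_of_ciInf_lt ha
  set s := 2 * k + 1 with hs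
  -- The fraction of `Λ_N` filled by the largest tiled cube that fits; fewer than `s` layers remain,
  -- so it tends to 1.
  set ρ : ℕ → ℝ := fun N => ((box d (s * ((N - k) / s) + k)).card : ℝ) / (box d N).card with hρ
  have hle : ∀ N, k ≤ N → s * ((N - k) / s) + k ≤ N := fun N hN => by
    have := Nat.mul_div_le (N - k) s
    omega
  have hρ1 : Tendsto ρ atTop (𝓝 1) := by
    refine tendsto_of_tendsto_of_tendsto_of_le_of_le' (tendsto_card_box_ratio (d := d) s)
      tendsto_const_nhds ?_ ?_
    · filter_upwards [eventually_ge_atTop k] with N hN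
      simp only [hρ]
      have h1 : N - s ≤ s * ((N - k) / s) + k := by
        have := Nat.lt_mul_div_succ (N - k) (show 0 < s by omega)
        rw [mul_add] at this
        omega
      have := Finset.card_le_card (box_mono (d := d) h1)
      gcongr
    · filter_upwards [eventually_ge_atTop k] with N hN
      refine (div_le_one (card_box_pos N)).2 ?_
      exact_mod_cast Finset.card_le_card (box_mono (d := d) (hle N hN))
  have hlim : Tendsto (fun N => ρ N * (q (box d k) / (box d k).card) + (1 - ρ N) * q {0}) atTop
      (𝓝 (1 * (q (box d k) / (box d k).card) + (1 - 1) * q {0})) :=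
    (hρ1.mul_const _).add ((hρ1.const_sub 1).mul_const _)
  rw [sub_self, zero_mul, add_zero, one_mul] at hlim
  filter_upwards [hlim.eventually_lt_const hk, eventually_ge_atTop k] with N hN hkN
  refine lt_of_le_of_lt ?_ hN
  have hb := hq.box_le k ((N - k) / s) N (hle N hkN)
  have hc : ((box d (s * ((N - k) / s) + k)).card : ℝ) =
      (box d ((N - k) / s)).card * (box d k).card := by
    rw [card_box, card_box, card_box]
    push_cast
    rw [← mul_pow]
    congr 1
    rw [hs]; push_cast; ring
  have hp := card_box_pos (d := d) N
  have hp' := card_box_pos (d := d) k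
  rw [div_le_iff₀ hp]
  refine hb.trans (le_of_eq ?_)
  simp only [hρ]
  rw [← hs, hc]
  field_simp

end IsSubadditiveOnRegions

/-! ### Translations and quasilocal observables. -/

theorem shift_shift (x y : Site d) (σ : Config d S) : shift x (shift y σ) = shift (x + y) σ := by
  funext z; simp [shift, add_assoc]

theorem shift_zero (σ : Config d S) : shift 0 σ = σ := by
  funext z; simp [shift]

theorem shift_surjective (x : Site d) : Function.Surjective (shift x : Config d S → Config d S) :=
  fun σ => ⟨shift (-x) σ, by rw [shift_shift, add_neg_cancel, shift_zero]⟩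

/-- Bounded functions that are uniform limits of local functions. -/
structure IsQuasilocal (h : Config d S → ℝ) : Prop where
  bounded : ∃ C, ∀ ω, |h ω| ≤ C
  approx : ∀ ε > 0, ∃ k, ∀ ω ω', (∀ x ∈ box d k, ω x = ω' x) → |h ω - h ω'| ≤ ε

namespace IsQuasilocal

variable {h g : Config d S → ℝ}

theorem add (hh : IsQuasilocal h) (hg : IsQuasilocal g) : IsQuasilocal fun ω => h ω + g ω where
  bounded := by
    obtain ⟨C, hC⟩ := hh.bounded
    obtain ⟨D, hD⟩ := hg.bounded
    exact ⟨C + D, fun ω => (abs_add_le _ _).trans (add_le_add (hC ω) (hD ω))⟩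
  approx ε hε := by
    obtain ⟨k, hk⟩ := hh.approx (ε / 2) (by positivity)
    obtain ⟨l, hl⟩ := hg.approx (ε / 2) (by positivity)
    refine ⟨max k l, fun ω ω' hω => ?_⟩
    have h1 := hk ω ω' fun x hx => hω x (box_mono (le_max_left _ _) hx)
    have h2 := hl ω ω' fun x hx => hω x (box_mono (le_max_right _ _) hx)
    rw [abs_le] at *
    constructor <;> linarith [h1.1, h1.2, h2.1, h2.2]

theorem const_mul (hh : IsQuasilocal h) (c : ℝ) : IsQuasilocal fun ω => c * h ω where
  bounded := by
    obtain ⟨C, hC⟩ := hh.bounded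
    refine ⟨|c| * C, fun ω => ?_⟩
    rw [abs_mul]
    exact mul_le_mul_of_nonneg_left (hC ω) (abs_nonneg c)
  approx ε hε := by
    obtain ⟨k, hk⟩ := hh.approx (ε / (|c| + 1)) (by positivity)
    refine ⟨k, fun ω ω' hω => ?_⟩
    rw [← mul_sub, abs_mul]
    have h1 := hk ω ω' hω
    rw [le_div_iff₀ (by positivity)] at h1
    nlinarith [abs_nonneg (h ω - h ω')]

theorem zero : IsQuasilocal fun _ : Config d S => (0 : ℝ) where
  bounded := ⟨0, by simp⟩
  approx ε hε := ⟨0, fun _ _ _ => by simpa using hε.le⟩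

theorem sum {ι : Type*} (s : Finset ι) {h : ι → Config d S → ℝ}
    (hh : ∀ i ∈ s, IsQuasilocal (h i)) : IsQuasilocal fun ω => ∑ i ∈ s, h i ω := by
  classical
  induction s using Finset.induction_on with
  | empty => simpa using zero
  | insert a s ha ih =>
    simp only [Finset.sum_insert ha]
    exact (hh a (by simp)).add (ih fun i hi => hh i (by simp [hi]))

/-- A quasilocal function is the pointwise limit of functions of finitely many spins, obtained by
resetting the spins off `Λ_n` to a fixed value. -/
theorem measurable [Finite S] [MeasurableSpace S] [DiscreteMeasurableSpace S]
    (hh : IsQuasilocal h) : Measurable h := by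
  rcases isEmpty_or_nonempty S with hS | ⟨⟨s⟩⟩
  · exact measurable_of_empty h
  let cut : (n : ℕ) → (box d n → S) → Config d S := fun n τ x =>
    if hx : x ∈ box d n then τ ⟨x, hx⟩ else s
  refine measurable_of_tendsto_metrizable
    (f := fun n ω => h (cut n ((box d n).restrict ω))) (fun n => ?_) ?_
  · exact (measurable_of_finite fun τ => h (cut n τ)).comp (Finset.measurable_restrict _)
  · rw [tendsto_pi_nhds]
    intro ω
    rw [Metric.tendsto_atTop]
    intro ε hε
    obtain ⟨k, hk⟩ := hh.approx (ε / 2) (by positivity)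
    refine ⟨k, fun n hn => ?_⟩
    rw [Real.dist_eq]
    refine (hk _ _ fun x hx => ?_).trans_lt (by linarith)
    simp [cut, box_mono hn hx]

/-- The sums over a cube of the translates of `h` depend weakly on the spins off the cube. -/
theorem eventually_abs_sum_sub_le (hh : IsQuasilocal h) {ε : ℝ} (hε : 0 < ε) :
    ∀ᶠ n in atTop, ∀ ω ω' : Config d S, (∀ x ∈ box d n, ω x = ω' x) →
      |∑ x ∈ box d n, h (shift x ω) - ∑ x ∈ box d n, h (shift x ω')| ≤ ε * (box d n).card := by
  obtain ⟨C, hC⟩ := hh.bounded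
  obtain ⟨k, hk⟩ := hh.approx (ε / 2) (by positivity)
  filter_upwards [eventually_sum_box_le (C := C + C) (half_pos hε) k] with n hn ω ω' hω
  rw [← Finset.sum_sub_distrib]
  refine (Finset.abs_sum_le_sum_abs _ _).trans ?_
  refine (hn _ ?_ ?_).trans (le_of_eq (by ring))
  · intro x _
    exact (abs_sub _ _).trans (add_le_add (hC _) (hC _))
  · intro x hx
    refine hk _ _ fun y hy => hω _ (hx ?_)
    rw [mem_translate]
    simpa using hy

end IsQuasilocal

/-! ### Partition functions and the pressure. -/

/-- The largest value of `∑_{x ∈ Λ} h ∘ τ_x` on the configurations that extend `τ`. -/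
def supSum (h : Config d S → ℝ) (Λ : Finset (Site d)) (τ : Λ → S) : ℝ :=
  ⨆ ω : {ω : Config d S // Λ.restrict ω = τ}, ∑ x ∈ Λ, h (shift x ω.1)

/-- The finite-volume partition function of `h`. -/
def partitionFun [Fintype S] (h : Config d S → ℝ) (Λ : Finset (Site d)) : ℝ :=
  ∑ τ : Λ → S, Real.exp (supSum h Λ τ)

/-- The thermodynamic limit of the pressure of `h` along cubes. -/
def pressure [Fintype S] (h : Config d S → ℝ) : ℝ :=
  limUnder atTop fun n => Real.log (partitionFun h (box d n)) / (box d n).card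

section

variable {h : Config d S → ℝ} {Λ : Finset (Site d)}

theorem restrict_surjective [Nonempty S] (Λ : Finset (Site d)) :
    Function.Surjective (Λ.restrict : Config d S → Λ → S) := fun τ => by
  classical
  exact ⟨fun x => if hx : x ∈ Λ then τ ⟨x, hx⟩ else Classical.arbitrary S, by
    funext x; simp⟩

theorem restrict_eq_restrict_iff {ω ω' : Config d S} :
    Λ.restrict ω = Λ.restrict ω' ↔ ∀ x ∈ Λ, ω x = ω' x := by
  simp [funext_iff]

instance [Nonempty S] (τ : Λ → S) : Nonempty {ω : Config d S // Λ.restrict ω = τ} :=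
  let ⟨ω, hω⟩ := restrict_surjective Λ τ
  ⟨⟨ω, hω⟩⟩

theorem abs_sum_shift_le {C : ℝ} (hC : ∀ ω, |h ω| ≤ C) (Λ : Finset (Site d)) (ω : Config d S) :
    |∑ x ∈ Λ, h (shift x ω)| ≤ C * Λ.card := by
  refine (Finset.abs_sum_le_sum_abs _ _).trans ?_
  refine (Finset.sum_le_card_nsmul _ _ C fun x _ => hC _).trans ?_
  rw [nsmul_eq_mul, mul_comm]

theorem le_supSum {C : ℝ} (hC : ∀ ω, |h ω| ≤ C) (Λ : Finset (Site d)) (ω : Config d S) :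
    ∑ x ∈ Λ, h (shift x ω) ≤ supSum h Λ (Λ.restrict ω) := by
  refine le_ciSup (f := fun ω' : {ω' : Config d S // Λ.restrict ω' = Λ.restrict ω} =>
    ∑ x ∈ Λ, h (shift x ω'.1)) ?_ ⟨ω, rfl⟩
  refine ⟨C * Λ.card, ?_⟩
  rintro _ ⟨ω', rfl⟩
  exact (le_abs_self _).trans (abs_sum_shift_le hC Λ _)

theorem supSum_le [Nonempty S] {τ : Λ → S} {c : ℝ}
    (hc : ∀ ω, Λ.restrict ω = τ → ∑ x ∈ Λ, h (shift x ω) ≤ c) : supSum h Λ τ ≤ c :=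
  ciSup_le fun ω => hc ω.1 ω.2

theorem partitionFun_pos [Fintype S] [Nonempty S] (h : Config d S → ℝ) (Λ : Finset (Site d)) :
    0 < partitionFun h Λ :=
  Finset.sum_pos (fun _ _ => Real.exp_pos _) Finset.univ_nonempty

theorem partitionFun_empty [Fintype S] [Nonempty S] (h : Config d S → ℝ) :
    partitionFun h ∅ = 1 := by
  simp [partitionFun, supSum]

/-- A supremum of a sum is at most the sum of the suprema, and a configuration on `A ∪ B` is
determined by its two restrictions. -/
theorem partitionFun_union_le [Fintype S] [Nonempty S] {C : ℝ} (hC : ∀ ω, |h ω| ≤ C)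
    {A B : Finset (Site d)} (hAB : Disjoint A B) :
    partitionFun h (A ∪ B) ≤ partitionFun h A * partitionFun h B := by
  classical
  let e : (((A ∪ B : Finset (Site d)) : Type) → S) ↪ (A → S) × (B → S) :=
    ⟨fun τ => (fun x => τ ⟨x, Finset.mem_union_left _ x.2⟩,
      fun x => τ ⟨x, Finset.mem_union_right _ x.2⟩), by
      intro τ τ' hτ
      rw [Prod.mk.injEq] at hτ
      funext x
      obtain ⟨x, hx⟩ := x
      rcases Finset.mem_union.1 hx with h' | h'
      · exact congrFun hτ.1 ⟨x, h'⟩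
      · exact congrFun hτ.2 ⟨x, h'⟩⟩
  have h1 : partitionFun h A * partitionFun h B =
      ∑ p : (A → S) × (B → S), Real.exp (supSum h A p.1) * Real.exp (supSum h B p.2) := by
    rw [partitionFun, partitionFun, Finset.sum_mul_sum, Fintype.sum_prod_type]
  rw [h1]
  calc partitionFun h (A ∪ B)
      ≤ ∑ τ, Real.exp (supSum h A (e τ).1) * Real.exp (supSum h B (e τ).2) := by
        refine Finset.sum_le_sum fun τ _ => ?_
        rw [← Real.exp_add, Real.exp_le_exp]
        refine supSum_le fun ω hω => ?_
        rw [Finset.sum_union hAB]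
        have hA : A.restrict ω = (e τ).1 := by rw [← hω]; rfl
        have hB : B.restrict ω = (e τ).2 := by rw [← hω]; rfl
        rw [← hA, ← hB]
        exact add_le_add (le_supSum hC _ _) (le_supSum hC _ _)
    _ = ∑ p ∈ Finset.univ.map e, Real.exp (supSum h A p.1) * Real.exp (supSum h B p.2) := by
        rw [Finset.sum_map]
    _ ≤ _ := Finset.sum_le_univ_sum_of_nonneg fun p => by positivity

theorem sum_translate (A : Finset (Site d)) (y : Site d) (g : Site d → ℝ) :
    ∑ x ∈ translate A y, g x = ∑ x ∈ A, g (x + y) := by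
  simp [translate]

theorem partitionFun_translate [Fintype S] (h : Config d S → ℝ) (A : Finset (Site d))
    (y : Site d) : partitionFun h (translate A y) = partitionFun h A := by
  have hm : ∀ x, x ∈ A → x + y ∈ translate A y := fun x hx => by
    rw [mem_translate]; simpa using hx
  let e : A ≃ translate A y :=
    ⟨fun x => ⟨x + y, hm x x.2⟩, fun x => ⟨x - y, mem_translate.1 x.2⟩,
      fun x => by simp, fun x => by simp⟩
  refine (Fintype.sum_equiv (e.arrowCongr (Equiv.refl S)) _ _ fun τ => ?_).symm
  congr 1
  let E : {ω : Config d S // A.restrict ω = τ} ≃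
      {ω : Config d S // (translate A y).restrict ω = e.arrowCongr (Equiv.refl S) τ} :=
    { toFun := fun ω => ⟨shift (-y) ω.1, by
        funext x
        have := congrFun ω.2 (e.symm x)
        simpa [shift, e, sub_eq_add_neg] using this⟩
      invFun := fun ω => ⟨shift y ω.1, by
        funext x
        have := congrFun ω.2 (e x)
        simpa [shift, e] using this⟩
      left_inv := fun ω => Subtype.ext (by simp [shift_shift, shift_zero])
      right_inv := fun ω => Subtype.ext (by simp [shift_shift, shift_zero]) }
  refine Equiv.iSup_congr E fun ω => ?_
  refine (sum_translate A y _).trans (Finset.sum_congr rfl fun x _ => ?_)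
  simp [E, shift_shift]

theorem isSubadditiveOnRegions_log_partitionFun [Fintype S] [Nonempty S] {C : ℝ}
    (hC : ∀ ω, |h ω| ≤ C) :
    IsSubadditiveOnRegions fun A : Finset (Site d) => Real.log (partitionFun h A) where
  empty := by simp [partitionFun_empty]
  union A B hAB := by
    rw [← Real.log_mul (partitionFun_pos h A).ne' (partitionFun_pos h B).ne']
    exact Real.log_le_log (partitionFun_pos h _) (partitionFun_union_le hC hAB)
  translate A x := by rw [partitionFun_translate]

theorem neg_mul_card_le_log_partitionFun [Fintype S] [Nonempty S] {C : ℝ}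
    (hC : ∀ ω, |h ω| ≤ C) (A : Finset (Site d)) :
    -C * A.card ≤ Real.log (partitionFun h A) := by
  rw [Real.le_log_iff_exp_le (partitionFun_pos h A)]
  let ω : Config d S := Classical.arbitrary _
  have h1 := le_supSum hC A ω
  have h2 := (abs_le.1 (abs_sum_shift_le hC A ω)).1
  refine le_trans (Real.exp_le_exp.2 (by linarith : -C * A.card ≤ supSum h A (A.restrict ω))) ?_
  exact Finset.single_le_sum (f := fun τ => Real.exp (supSum h A τ))
    (fun _ _ => (Real.exp_pos _).le) (Finset.mem_univ _)

theorem IsQuasilocal.tendsto_pressure [Fintype S] [Nonempty S] (hh : IsQuasilocal h) :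
    Tendsto (fun n => Real.log (partitionFun h (box d n)) / (box d n).card) atTop
      (𝓝 (pressure h)) := by
  obtain ⟨C, hC⟩ := hh.bounded
  exact tendsto_nhds_limUnder ((isSubadditiveOnRegions_log_partitionFun hC).exists_tendsto
    (neg_mul_card_le_log_partitionFun hC))

end

/-! ### The global symmetry behind the local involutions. -/

/-- A spin involution `f` and a lattice symmetry `θ` of order two that preserves all cubes. -/
structure IsSiteSymmetry (f : S → S) (θ : Site d → Site d) : Prop where
  involutive : Function.Involutive f
  site_involutive : Function.Involutive θ
  map_add : ∀ x y, θ (x + y) = θ x + θ y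
  map_mem_box : ∀ n, ∀ x ∈ box d n, θ x ∈ box d n

/-- The global transformation `σ ↦ f ∘ σ ∘ θ`. -/
def siteMap (f : S → S) (θ : Site d → Site d) (σ : Config d S) : Config d S :=
  fun x => f (σ (θ x))

namespace IsSiteSymmetry

variable {f : S → S} {θ : Site d → Site d}

theorem siteMap_involutive (hs : IsSiteSymmetry f θ) : Function.Involutive (siteMap f θ) :=
  fun σ => by funext x; simp [siteMap, hs.involutive _, hs.site_involutive _]

theorem siteMap_shift (hs : IsSiteSymmetry f θ) (x : Site d) (σ : Config d S) :
    siteMap f θ (shift x σ) = shift (θ x) (siteMap f θ σ) := by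
  funext y; simp [siteMap, shift, hs.map_add, hs.site_involutive _]

theorem shift_siteMap (hs : IsSiteSymmetry f θ) (x : Site d) (σ : Config d S) :
    shift x (siteMap f θ σ) = siteMap f θ (shift (θ x) σ) := by
  rw [hs.siteMap_shift, hs.site_involutive]

theorem sum_box_comp (hs : IsSiteSymmetry f θ) (n : ℕ) (g : Site d → ℝ) :
    ∑ x ∈ box d n, g (θ x) = ∑ x ∈ box d n, g x :=
  Finset.sum_nbij' θ θ (hs.map_mem_box n) (hs.map_mem_box n) (fun x _ => hs.site_involutive x)
    (fun x _ => hs.site_involutive x) fun _ _ => rfl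

theorem isQuasilocal_comp (hs : IsSiteSymmetry f θ) {h : Config d S → ℝ} (hh : IsQuasilocal h) :
    IsQuasilocal fun ω => h (siteMap f θ ω) where
  bounded := let ⟨C, hC⟩ := hh.bounded; ⟨C, fun ω => hC _⟩
  approx ε hε := by
    obtain ⟨k, hk⟩ := hh.approx ε hε
    refine ⟨k, fun ω ω' hω => hk _ _ fun x hx => ?_⟩
    rw [siteMap, siteMap, hω _ (hs.map_mem_box k x hx)]

/-- Moving the symmetry past a translation turns `x` into `θ x`; individual terms change, but the
sum over a cube is only reindexed. -/
theorem sum_shift_siteMap (hs : IsSiteSymmetry f θ) (h : Config d S → ℝ) (n : ℕ)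
    (ω : Config d S) :
    ∑ x ∈ box d n, h (shift x (siteMap f θ ω)) =
      ∑ x ∈ box d n, h (siteMap f θ (shift x ω)) := by
  simp only [hs.shift_siteMap]
  exact hs.sum_box_comp n fun x => h (siteMap f θ (shift x ω))

/-- The symmetry acts on the configurations of the cube because `θ` preserves it, and it carries the
extensions of `τ` onto those of the image of `τ`. -/
theorem partitionFun_comp [Fintype S] (hs : IsSiteSymmetry f θ) (h : Config d S → ℝ) (n : ℕ) :
    partitionFun (fun ω => h (siteMap f θ ω)) (box d n) = partitionFun h (box d n) := by
  let F : (box d n → S) → box d n → S := fun τ x => f (τ ⟨θ x, hs.map_mem_box n x x.2⟩)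
  have hF : Function.Involutive F := fun τ => by
    funext x
    simp only [F, hs.involutive _]
    congr 1
    exact Subtype.ext (hs.site_involutive _)
  have hFr : ∀ ω, (box d n).restrict (siteMap f θ ω) = F ((box d n).restrict ω) := fun ω => rfl
  refine Fintype.sum_equiv (hF.toPerm F) _ _ fun τ => ?_
  congr 1
  let E : {ω : Config d S // (box d n).restrict ω = τ} ≃
      {ω : Config d S // (box d n).restrict ω = hF.toPerm F τ} :=
    { toFun := fun ω => ⟨siteMap f θ ω.1, by rw [hFr, ω.2]; rfl⟩
      invFun := fun ω => ⟨siteMap f θ ω.1, by rw [hFr, ω.2]; exact hF τ⟩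
      left_inv := fun ω => Subtype.ext (hs.siteMap_involutive _)
      right_inv := fun ω => Subtype.ext (hs.siteMap_involutive _) }
  exact Equiv.iSup_congr E fun ω => hs.sum_shift_siteMap h n ω.1

theorem pressure_comp [Fintype S] (hs : IsSiteSymmetry f θ) (h : Config d S → ℝ) :
    pressure (fun ω => h (siteMap f θ ω)) = pressure h := by
  simp only [pressure, hs.partitionFun_comp h]

end IsSiteSymmetry

/-- A covariant family of local involutions is the restriction of a global site map. -/
theorem IsLocalInvolutionFamily.exists_isSiteSymmetry {π : ℕ → Config d S → Config d S}
    (hπ : IsLocalInvolutionFamily π) :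
    ∃ (f : S → S) (θ : Site d → Site d), IsSiteSymmetry f θ ∧
      ∀ n σ, ∀ x ∈ box d n, π n σ x = siteMap f θ σ x := by
  -- With at most one spin value the configurations cannot detect `θ`, so the identity is taken.
  -- Otherwise `θ x` is the `x'` of covariance and `f` is the action on the spin at `Λ_0 = {0}`.
  rcases subsingleton_or_nontrivial S with hS | hS
  · exact ⟨id, id, ⟨fun _ => rfl, fun _ => rfl, fun _ _ => rfl, fun _ _ h => h⟩,
      fun _ _ _ _ => Subsingleton.elim _ _⟩
  choose θ hθ using hπ.covariant
  let f : S → S := fun s => π 0 (fun _ => s) 0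
  have hf0 : ∀ σ, π 0 σ 0 = f (σ 0) := fun σ =>
    hπ.congr_on_box 0 _ _ (fun x hx => by rw [mem_box_zero.1 hx]) 0 (zero_mem_box 0)
  have hfn : ∀ n σ, π n σ 0 = f (σ 0) := fun n σ => by
    rw [← hπ.consistent 0 n (Nat.zero_le n) σ 0 (zero_mem_box 0), hf0]
  have hf : Function.Involutive f := fun s => by
    have h := congrFun (hπ.involutive 0 fun _ => s) 0
    rwa [hf0, hf0] at h
  -- Covariance at `y = 0`.
  have h1 : ∀ n σ x, θ x ∈ box d n → π n σ (θ x) = f (σ x) := fun n σ x hx => by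
    have h := hθ x n σ 0 (zero_mem_box n) (by simpa using hx)
    rw [hfn] at h
    simpa [shift] using h.symm
  -- Apply the previous identity to `π σ` in a cube also containing `θ x`, then cancel with `π ∘ π =
  -- 1` and `f ∘ f = 1`.
  have h2 : ∀ n σ, ∀ x ∈ box d n, π n σ x = f (σ (θ x)) := fun n σ x hx => by
    obtain ⟨k, hk⟩ := exists_mem_box (θ x)
    have hk' := box_mono (le_max_right n k) hk
    rw [hπ.consistent n (max n k) (le_max_left _ _) σ x hx]
    have h := h1 _ (π (max n k) σ) x hk'
    rw [hπ.involutive] at h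
    rw [h, hf]
  -- If `θ x` lay outside `Λ_n`, changing the spin there would change `π n σ x`, although `π n` sees
  -- only `Λ_n`.
  have hmem : ∀ n, ∀ x ∈ box d n, θ x ∈ box d n := fun n x hx => by
    by_contra hc
    obtain ⟨a, b, hab⟩ := exists_pair_ne S
    have h := hπ.congr_on_box n (fun _ => a) (Function.update (fun _ => a) (θ x) b)
      (fun y hy => by
        rw [Function.update_of_ne]
        rintro rfl
        exact hc hy) x hx
    rw [h2 _ _ _ hx, h2 _ _ _ hx, Function.update_self] at h
    exact hab (hf.injective h)
  have hsep : ∀ x y : Site d, (∀ σ : Config d S, σ x = σ y) → x = y := fun x y h => by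
    by_contra hc
    obtain ⟨a, b, hab⟩ := exists_pair_ne S
    have := h (Function.update (fun _ => a) x b)
    rw [Function.update_self, Function.update_of_ne (Ne.symm hc)] at this
    exact hab this.symm
  have hinv : Function.Involutive θ := fun x => by
    obtain ⟨n, hn⟩ := exists_mem_box x
    refine hsep _ _ fun σ => ?_
    have h := congrFun (hπ.involutive n σ) x
    rwa [h2 _ _ _ hn, h2 _ _ _ (hmem n x hn), hf] at h
  -- Covariance at a general `y`, with both sides rewritten through `f` and `θ`; replacing `x` by `θ
  -- x` yields additivity.
  have hadd : ∀ x y, θ (y + θ x) = θ y + x := fun x y => by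
    obtain ⟨n, hn⟩ := exists_subset_box {y, y + θ x}
    have hy : y ∈ box d n := hn (by simp)
    have hxy : y + θ x ∈ box d n := hn (by simp)
    refine hsep _ _ fun σ => ?_
    have h := hθ x n σ y hy hxy
    rw [h2 _ _ _ hy, shift, shift, h2 _ _ _ hxy] at h
    exact (hf.injective h).symm
  refine ⟨f, θ, ⟨hf, hinv, fun x y => ?_, hmem⟩, h2⟩
  rw [← hadd, hinv]

/-- One choice of `f` and `θ` serves all potentials at once, since `U_A` sees only spins in `A ⊆
Λ_{n(A)}`. -/
theorem IsLocalInvolutionFamily.exists_isSiteSymmetry_potential {π : ℕ → Config d S → Config d S}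
    (hπ : IsLocalInvolutionFamily π) :
    ∃ (f : S → S) (θ : Site d → Site d), IsSiteSymmetry f θ ∧
      ∀ U : Finset (Site d) → Config d S → ℝ, IsPotential U → ∀ A σ,
        U A (π (boxIndex A) σ) = U A (siteMap f θ σ) := by
  obtain ⟨f, θ, hs, h⟩ := hπ.exists_isSiteSymmetry
  exact ⟨f, θ, hs, fun U hU A σ => hU.congr_on A _ _ fun x hx =>
    h _ σ x (subset_box_boxIndex A hx)⟩

/-! ### Potentials, energies per site and currents. -/

/-- The uniform norm `‖U_A‖`. -/
def potNorm (U : Finset (Site d) → Config d S → ℝ) (A : Finset (Site d)) : ℝ := ⨆ σ, |U A σ|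

/-- The energy per site `∑_{A ∋ 0} U_A / |A|`. -/
def siteEnergy (U : Finset (Site d) → Config d S → ℝ) (ω : Config d S) : ℝ :=
  ∑' A : Finset (Site d), if 0 ∈ A then U A ω / A.card else 0

/-- `∑ ‖U_A‖` over the sets `A ∋ x` that stick out of `Λ`. -/
def tailNorm (U : Finset (Site d) → Config d S → ℝ) (Λ : Finset (Site d)) (x : Site d) : ℝ :=
  ∑' A : Finset (Site d), if x ∈ A ∧ ¬ A ⊆ Λ then potNorm U A else 0

/-- Translation of regions as a bijection. -/
def translateEquiv (x : Site d) : Finset (Site d) ≃ Finset (Site d) where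
  toFun A := translate A x
  invFun A := translate A (-x)
  left_inv A := by ext y; simp [mem_translate]
  right_inv A := by ext y; simp [mem_translate]

theorem translateEquiv_apply (x : Site d) (A : Finset (Site d)) :
    translateEquiv x A = translate A x := rfl

theorem potNorm_nonneg (U : Finset (Site d) → Config d S → ℝ) (A : Finset (Site d)) :
    0 ≤ potNorm U A :=
  Real.iSup_nonneg fun _ => abs_nonneg _

theorem mem_translate_self {A : Finset (Site d)} {x : Site d} : x ∈ translate A x ↔ 0 ∈ A := by
  rw [mem_translate, sub_self]

namespace IsPotential

variable {U : Finset (Site d) → Config d S → ℝ}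

/-- The real supremum of an unbounded family is 0 by convention, so boundedness must be checked:
`U_A` factors through the finite set `A → S`. -/
theorem abs_le_potNorm [Finite S] (hU : IsPotential U) (A : Finset (Site d)) (σ : Config d S) :
    |U A σ| ≤ potNorm U A := by
  classical
  refine le_ciSup (f := fun σ => |U A σ|) (Set.Finite.bddAbove ?_) σ
  refine (Set.finite_range fun τ : A → S =>
    if h : ∃ σ : Config d S, A.restrict σ = τ then |U A h.choose| else 0).subset ?_
  rintro _ ⟨σ, rfl⟩
  have h : ∃ σ' : Config d S, A.restrict σ' = A.restrict σ := ⟨σ, rfl⟩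
  refine ⟨A.restrict σ, ?_⟩
  simp only [dif_pos h]
  rw [hU.congr_on A h.choose σ (restrict_eq_restrict_iff.1 h.choose_spec)]

theorem potNorm_translate (hU : IsPotential U) (A : Finset (Site d)) (x : Site d) :
    potNorm U (translate A x) = potNorm U A := by
  simp only [potNorm, hU.translation]
  exact (shift_surjective x).iSup_comp fun σ => |U A σ|

theorem summable_mem (hU : IsPotential U) (x : Site d) :
    Summable fun A : Finset (Site d) => if x ∈ A then potNorm U A else 0 := by
  have h0 : Summable fun A : Finset (Site d) => if 0 ∈ A then potNorm U A else 0 := by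
    have := (summable_subtype_iff_indicator (f := potNorm U)
      (s := {A : Finset (Site d) | (0 : Site d) ∈ A})).1 hU.summable
    refine this.congr fun A => ?_
    by_cases h : (0 : Site d) ∈ A <;> simp [Set.indicator, h]
  rw [← (translateEquiv x).summable_iff]
  refine h0.congr fun A => ?_
  simp only [Function.comp_apply, translateEquiv_apply, mem_translate_self, hU.potNorm_translate]

theorem summable_tailNorm (hU : IsPotential U) (Λ : Finset (Site d)) (x : Site d) :
    Summable fun A : Finset (Site d) => if x ∈ A ∧ ¬ A ⊆ Λ then potNorm U A else 0 := by
  refine (hU.summable_mem x).of_nonneg_of_le (fun A => ?_) fun A => ?_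
  · split_ifs; exacts [potNorm_nonneg U A, le_rfl]
  · by_cases h : x ∈ A <;> by_cases h' : A ⊆ Λ <;> simp [h, h', potNorm_nonneg U A]

theorem tailNorm_eq (hU : IsPotential U) (Λ : Finset (Site d)) (x : Site d) :
    tailNorm U Λ x =
      ∑' A : Finset (Site d), if 0 ∈ A ∧ ¬ translate A x ⊆ Λ then potNorm U A else 0 := by
  rw [tailNorm, ← (translateEquiv x).tsum_eq]
  simp only [translateEquiv_apply, mem_translate_self, hU.potNorm_translate]

theorem tailNorm_le_total (hU : IsPotential U) (Λ : Finset (Site d)) (x : Site d) :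
    tailNorm U Λ x ≤ ∑' A : Finset (Site d), if 0 ∈ A then potNorm U A else 0 := by
  rw [hU.tailNorm_eq]
  have hle : ∀ A : Finset (Site d), (if 0 ∈ A ∧ ¬ translate A x ⊆ Λ then potNorm U A else 0) ≤
      if 0 ∈ A then potNorm U A else 0 := fun A => by
    by_cases h : 0 ∈ A <;> by_cases h' : translate A x ⊆ Λ <;> simp [h, h', potNorm_nonneg U A]
  refine Summable.tsum_le_tsum hle ?_ (hU.summable_mem 0)
  refine (hU.summable_mem 0).of_nonneg_of_le (fun A => ?_) hle
  split_ifs; exacts [potNorm_nonneg U A, le_rfl]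

/-- After translating back to the origin, a set that leaves `Λ` must leave `B`. The bound is uniform
over sites deep inside `Λ`. -/
theorem tailNorm_le_of_translate_subset (hU : IsPotential U) {Λ B : Finset (Site d)} {x : Site d}
    (h : translate B x ⊆ Λ) : tailNorm U Λ x ≤ tailNorm U B 0 := by
  rw [hU.tailNorm_eq]
  have hle : ∀ A : Finset (Site d), (if 0 ∈ A ∧ ¬ translate A x ⊆ Λ then potNorm U A else 0) ≤
      if 0 ∈ A ∧ ¬ A ⊆ B then potNorm U A else 0 := fun A => by
    by_cases h1 : 0 ∈ A ∧ ¬ translate A x ⊆ Λ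
    · rw [if_pos h1, if_pos ⟨h1.1, fun h2 => h1.2 ((Finset.map_subset_map.2 h2).trans h)⟩]
    · rw [if_neg h1]
      split_ifs; exacts [potNorm_nonneg U A, le_rfl]
  refine Summable.tsum_le_tsum hle ?_ (hU.summable_tailNorm B 0)
  refine (hU.summable_tailNorm B 0).of_nonneg_of_le (fun A => ?_) hle
  split_ifs; exacts [potNorm_nonneg U A, le_rfl]

theorem tendsto_tailNorm (hU : IsPotential U) :
    Tendsto (fun k => tailNorm U (box d k) 0) atTop (𝓝 0) := by
  have h := tendsto_tsum_of_dominated_convergence (𝓕 := atTop)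
    (f := fun (k : ℕ) (A : Finset (Site d)) =>
      if 0 ∈ A ∧ ¬ A ⊆ box d k then potNorm U A else 0) (g := fun _ => 0) (hU.summable_mem 0)
    (fun A => ?_) (Eventually.of_forall fun k A => ?_)
  · rwa [tsum_zero] at h
  · obtain ⟨N, hN⟩ := exists_subset_box A
    refine tendsto_const_nhds.congr' ?_
    filter_upwards [eventually_ge_atTop N] with k hk
    rw [if_neg fun h => h.2 (hN.trans (box_mono hk))]
  · by_cases h : 0 ∈ A <;> by_cases h' : A ⊆ box d k <;>
      simp [h, h', potNorm_nonneg U A, abs_of_nonneg]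

variable [Finite S]

theorem abs_div_card_le (hU : IsPotential U) (A : Finset (Site d)) (σ : Config d S) :
    |U A σ / A.card| ≤ potNorm U A := by
  refine le_trans ?_ (hU.abs_le_potNorm A σ)
  rw [abs_div, Nat.abs_cast]
  rcases Nat.eq_zero_or_pos A.card with h | h
  · simp [h]
  · exact div_le_self (abs_nonneg _) (by exact_mod_cast h)

theorem hasSum_siteEnergy_shift (hU : IsPotential U) (x : Site d) (ω : Config d S) :
    HasSum (fun A : Finset (Site d) => if x ∈ A then U A ω / A.card else 0)
      (siteEnergy U (shift x ω)) := by
  have hs : Summable fun A : Finset (Site d) => if x ∈ A then U A ω / A.card else 0 := by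
    refine (hU.summable_mem x).of_norm_bounded fun A => ?_
    by_cases h : x ∈ A
    · rw [if_pos h, if_pos h]; exact hU.abs_div_card_le A ω
    · simp [h]
  convert hs.hasSum using 1
  rw [siteEnergy, ← (translateEquiv x).tsum_eq
    fun A : Finset (Site d) => if x ∈ A then U A ω / (A.card : ℝ) else 0]
  simp only [translateEquiv_apply, mem_translate_self, hU.translation, card_translate]

theorem hasSum_siteEnergy (hU : IsPotential U) (ω : Config d S) :
    HasSum (fun A : Finset (Site d) => if 0 ∈ A then U A ω / A.card else 0)
      (siteEnergy U ω) := by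
  simpa only [shift_zero] using hU.hasSum_siteEnergy_shift 0 ω

theorem isQuasilocal_siteEnergy (hU : IsPotential U) : IsQuasilocal (siteEnergy U) where
  bounded := by
    refine ⟨∑' A : Finset (Site d), if 0 ∈ A then potNorm U A else 0, fun ω => ?_⟩
    rw [siteEnergy, ← Real.norm_eq_abs]
    refine tsum_of_norm_bounded (hU.summable_mem 0).hasSum fun A => ?_
    by_cases h : 0 ∈ A
    · rw [if_pos h, if_pos h]; exact hU.abs_div_card_le A ω
    · simp [h]
  approx ε hε := by
    obtain ⟨k, hk⟩ := (hU.tendsto_tailNorm.eventually_le_const (half_pos hε)).exists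
    refine ⟨k, fun ω ω' hω => ?_⟩
    have h := (hU.hasSum_siteEnergy ω).sub (hU.hasSum_siteEnergy ω')
    rw [← h.tsum_eq, ← Real.norm_eq_abs]
    -- Sets inside `Λ_k` cancel; every other one costs at most twice its norm.
    refine le_trans (tsum_of_norm_bounded (a := 2 * tailNorm U (box d k) 0)
      ((hU.summable_tailNorm (box d k) 0).hasSum.mul_left 2) fun A => ?_) (by linarith)
    by_cases h0 : 0 ∈ A
    · by_cases hA : A ⊆ box d k
      · simp [h0, hA, hU.congr_on A ω ω' fun x hx => hω x (hA hx)]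
      · simp only [if_pos h0, if_pos (And.intro h0 hA)]
        rw [two_mul]
        exact (norm_sub_le _ _).trans
          (add_le_add (hU.abs_div_card_le A ω) (hU.abs_div_card_le A ω'))
    · simp [h0]

/-- Up to a boundary term, the relative energy in `Λ` is a sum of energies per site. -/
theorem abs_relEnergy_sub_le (hU : IsPotential U) {Λ : Finset (Site d)} {ω ω' : Config d S}
    (hω : ∀ x ∉ Λ, ω x = ω' x) :
    |relEnergy U ω ω' -
      (∑ x ∈ Λ, siteEnergy U (shift x ω) - ∑ x ∈ Λ, siteEnergy U (shift x ω'))| ≤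
      ∑ x ∈ Λ, 2 * tailNorm U Λ x := by
  set D : Finset (Site d) → ℝ := fun A => U A ω - U A ω' with hD
  have hDle : ∀ A, |D A| ≤ 2 * potNorm U A := fun A => by
    rw [two_mul]
    exact (abs_sub _ _).trans (add_le_add (hU.abs_le_potNorm A ω) (hU.abs_le_potNorm A ω'))
  have hcard : ∀ (A : Finset (Site d)) (c : ℝ),
      ∑ x ∈ Λ, (if x ∈ A then c else 0) = (Λ ∩ A).card * c := fun A c => by
    rw [Finset.sum_ite_mem, Finset.sum_const, nsmul_eq_mul]
  have hD0 : ∀ A, Λ ∩ A = ∅ → D A = 0 := fun A hA => by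
    rw [hD]
    simp only [sub_eq_zero]
    refine hU.congr_on A _ _ fun x hx => hω x fun hxΛ => ?_
    have : x ∈ Λ ∩ A := Finset.mem_inter.2 ⟨hxΛ, hx⟩
    simp [hA] at this
  have hone : ∀ A, Λ ∩ A ≠ ∅ → (1 : ℝ) ≤ (Λ ∩ A).card := fun A hA => by
    exact_mod_cast Finset.card_pos.2 (Finset.nonempty_iff_ne_empty.2 hA)
  -- Only sets meeting `Λ` contribute, and each is dominated by its terms in the sums over `x ∈ Λ`.
  have hDs : Summable D := by
    refine (summable_sum (s := Λ) fun x _ => (hU.summable_mem x).mul_left 2).of_norm_bounded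
      fun A => ?_
    rw [← Finset.mul_sum, hcard]
    by_cases hA : Λ ∩ A = ∅
    · simp [hD0 A hA, hA]
    · refine (hDle A).trans ?_
      have := mul_le_mul_of_nonneg_right (hone A hA) (potNorm_nonneg U A)
      linarith
  have hsum := hDs.hasSum.sub (hasSum_sum (s := Λ) fun x _ =>
    (hU.hasSum_siteEnergy_shift x ω).sub (hU.hasSum_siteEnergy_shift x ω'))
  rw [Finset.sum_sub_distrib] at hsum
  rw [relEnergy, ← hsum.tsum_eq, ← Real.norm_eq_abs]
  refine tsum_of_norm_bounded (hasSum_sum (s := Λ) fun x _ =>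
    (hU.summable_tailNorm Λ x).hasSum.mul_left 2) fun A => ?_
  -- The energies per site count `D A` with weight `|Λ ∩ A| / |A|`. This weight is 1 when `A ⊆ Λ`,
  -- so only sets that meet `Λ` and stick out leave an error.
  have h1 : ∑ x ∈ Λ, ((if x ∈ A then U A ω / A.card else 0) -
      if x ∈ A then U A ω' / A.card else 0) = (Λ ∩ A).card * (D A / A.card) := by
    rw [← hcard]
    refine Finset.sum_congr rfl fun x _ => ?_
    split_ifs
    · rw [hD, sub_div]
    · simp
  rw [h1, Real.norm_eq_abs]
  by_cases hA : Λ ∩ A = ∅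
  · rw [hD0 A hA]
    simp only [zero_div, mul_zero, sub_zero, abs_zero]
    exact Finset.sum_nonneg fun x _ => mul_nonneg zero_le_two (by
      split_ifs; exacts [potNorm_nonneg U A, le_rfl])
  have hpos : (0 : ℝ) < A.card := by
    have := Finset.card_le_card (Finset.inter_subset_right (s₁ := Λ) (s₂ := A))
    have h2 := hone A hA
    have h3 : ((Λ ∩ A).card : ℝ) ≤ A.card := by exact_mod_cast this
    linarith
  by_cases hAΛ : A ⊆ Λ
  · rw [Finset.inter_eq_right.2 hAΛ, mul_div_cancel₀ _ hpos.ne', sub_self, abs_zero]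
    exact Finset.sum_nonneg fun x _ => by simp [hAΛ]
  · simp only [hAΛ, not_false_eq_true, and_true]
    rw [← Finset.mul_sum, hcard]
    have h3 : ((Λ ∩ A).card : ℝ) ≤ A.card := by
      exact_mod_cast Finset.card_le_card Finset.inter_subset_right
    have h4 : D A - (Λ ∩ A).card * (D A / A.card) = (1 - (Λ ∩ A).card / A.card) * D A := by
      field_simp
    have h5 : ((Λ ∩ A).card : ℝ) / A.card ≤ 1 := (div_le_one hpos).2 h3
    have h6 : (0 : ℝ) ≤ (Λ ∩ A).card / A.card := by positivity
    rw [h4, abs_mul, abs_of_nonneg (by linarith)]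
    have h7 := mul_le_mul_of_nonneg_right (hone A hA) (potNorm_nonneg U A)
    have h8 := mul_le_mul_of_nonneg_right
      (show 1 - ((Λ ∩ A).card : ℝ) / A.card ≤ 1 by linarith) (abs_nonneg (D A))
    have h9 := hDle A
    linarith

theorem eventually_abs_relEnergy_sub_le (hU : IsPotential U) {ε : ℝ} (hε : 0 < ε) :
    ∀ᶠ n in atTop, ∀ ω ω' : Config d S, (∀ x ∉ box d n, ω x = ω' x) →
      |relEnergy U ω ω' - (∑ x ∈ box d n, siteEnergy U (shift x ω) -
        ∑ x ∈ box d n, siteEnergy U (shift x ω'))| ≤ ε * (box d n).card := by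
  obtain ⟨k, hk⟩ := (hU.tendsto_tailNorm.eventually_le_const
    (show 0 < ε / 4 by positivity)).exists
  filter_upwards [eventually_sum_box_le (d := d)
    (C := 2 * ∑' A : Finset (Site d), if 0 ∈ A then potNorm U A else 0) (half_pos hε) k]
    with n hn ω ω' hω
  refine (hU.abs_relEnergy_sub_le hω).trans ((hn _ ?_ ?_).trans (le_of_eq (by ring)))
  · intro x _
    have := hU.tailNorm_le_total (box d n) x
    linarith
  · intro x hx
    have := hU.tailNorm_le_of_translate_subset hx
    linarith

/-- The approximations are partial sums, over the subsets of `Λ_n`, of a series dominated by the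
summable norms `‖U_A‖`, and these families of subsets exhaust all finite sets. -/
theorem tendstoUniformly_currentApprox (hU : IsPotential U) {π : ℕ → Config d S → Config d S}
    {F : Config d S → Config d S} (hF : ∀ A σ, U A (π (boxIndex A) σ) = U A (F σ))
    (x : Site d) :
    TendstoUniformly (currentApprox π U x)
      (fun σ => (siteEnergy U (shift x (F σ)) - siteEnergy U (shift x σ)) / 2) atTop := by
  have h1 := tendstoUniformly_tsum (hU.summable_mem x)
    (f := fun A σ => ((if x ∈ A then U A (F σ) / A.card else 0) -
      if x ∈ A then U A σ / A.card else 0) / 2) fun A σ => by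
    by_cases h : x ∈ A
    · simp only [if_pos h, Real.norm_eq_abs]
      have h1 := hU.abs_div_card_le A (F σ)
      have h2 := hU.abs_div_card_le A σ
      rw [abs_le] at *
      constructor <;> linarith [h1.1, h1.2, h2.1, h2.2]
    · simp [h]
  have h2 : ∀ σ, ∑' A : Finset (Site d), ((if x ∈ A then U A (F σ) / A.card else 0) -
      if x ∈ A then U A σ / A.card else 0) / 2 =
      (siteEnergy U (shift x (F σ)) - siteEnergy U (shift x σ)) / 2 := fun σ =>
    (((hU.hasSum_siteEnergy_shift x (F σ)).sub (hU.hasSum_siteEnergy_shift x σ)).div_const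
      2).tsum_eq
  simp only [h2] at h1
  have h3 : Tendsto (fun n => (box d n).powerset) atTop atTop :=
    tendsto_atTop_finset_of_monotone
      (fun m n h => Finset.powerset_mono.2 (box_mono h)) fun A => by
        obtain ⟨n, hn⟩ := exists_subset_box A
        exact ⟨n, Finset.mem_powerset.2 hn⟩
  intro u hu
  filter_upwards [h3.eventually (h1 u hu)] with n hn σ
  convert hn σ using 2
  rw [currentApprox, Finset.sum_filter]
  refine Finset.sum_congr rfl fun A _ => ?_
  split_ifs
  · rw [hF]; ring
  · simp

theorem current_eq (hU : IsPotential U) {π : ℕ → Config d S → Config d S}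
    {F : Config d S → Config d S} (hF : ∀ A σ, U A (π (boxIndex A) σ) = U A (F σ))
    (x : Site d) (σ : Config d S) :
    current π U x σ = (siteEnergy U (shift x (F σ)) - siteEnergy U (shift x σ)) / 2 :=
  ((hU.tendstoUniformly_currentApprox hF x).tendsto_at σ).limUnder_eq

end IsPotential

/-! ### Linearity of the energy in the fields. -/

section

variable [Finite S] {m : ℕ} {U₀ : Finset (Site d) → Config d S → ℝ}
  {U : Fin m → Finset (Site d) → Config d S → ℝ}

theorem isPotential_totalPotential (hU₀ : IsPotential U₀) (hU : ∀ α, IsPotential (U α))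
    (E : Fin m → ℝ) : IsPotential (totalPotential U₀ U E) where
  empty σ := by simp [totalPotential, hU₀.empty, (hU _).empty]
  congr_on A σ η h := by
    simp only [totalPotential, hU₀.congr_on A σ η h, fun α => (hU α).congr_on A σ η h]
  translation A x σ := by
    simp only [totalPotential, hU₀.translation, (hU _).translation]
  summable := by
    refine (hU₀.summable.add (summable_sum (s := Finset.univ) fun α _ =>
      (hU α).summable.mul_left |E α|)).of_nonneg_of_le
      (fun A => Real.iSup_nonneg fun _ => abs_nonneg _) fun A => ?_
    refine Real.iSup_le (fun σ => ?_) ?_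
    · refine (abs_add_le _ _).trans (add_le_add (hU₀.abs_le_potNorm _ σ) ?_)
      refine (Finset.abs_sum_le_sum_abs _ _).trans (Finset.sum_le_sum fun α _ => ?_)
      rw [abs_mul]
      exact mul_le_mul_of_nonneg_left ((hU α).abs_le_potNorm _ σ) (abs_nonneg _)
    · exact add_nonneg (potNorm_nonneg U₀ A) (Finset.sum_nonneg fun α _ =>
        mul_nonneg (abs_nonneg _) (potNorm_nonneg (U α) A))

theorem siteEnergy_totalPotential (hU₀ : IsPotential U₀) (hU : ∀ α, IsPotential (U α))
    (E : Fin m → ℝ) (ω : Config d S) :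
    siteEnergy (totalPotential U₀ U E) ω =
      siteEnergy U₀ ω + ∑ α, E α * siteEnergy (U α) ω := by
  refine ((isPotential_totalPotential hU₀ hU E).hasSum_siteEnergy ω).unique ?_
  convert (hU₀.hasSum_siteEnergy ω).add (hasSum_sum (s := Finset.univ) fun α _ =>
    ((hU α).hasSum_siteEnergy ω).mul_left (E α)) using 2 with A
  split_ifs
  · simp only [totalPotential, add_div, Finset.sum_div, mul_div_assoc]
  · simp

end

/-! ### From the Gibbs property to pressures. -/

section

variable [MeasurableSpace S]

theorem measurableSet_agree [DiscreteMeasurableSpace S] (Λ : Finset (Site d)) (σ : Config d S) :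
    MeasurableSet {ω : Config d S | ∀ x ∈ Λ, ω x = σ x} := by
  have h : {ω : Config d S | ∀ x ∈ Λ, ω x = σ x} =
      ⋂ x ∈ Λ, (fun ω : Config d S => ω x) ⁻¹' {σ x} := by
    ext ω; simp
  rw [h]
  exact Finset.measurableSet_biInter Λ fun x _ =>
    measurable_pi_apply x (MeasurableSet.of_discrete)

theorem integral_localCondProb [DiscreteMeasurableSpace S] (μ : Measure (Config d S))
    [IsProbabilityMeasure μ] (Λ : Finset (Site d)) (σ : Config d S) :
    ∫ ξ, localCondProb μ Λ σ ξ ∂μ = μ.real {ω | ∀ x ∈ Λ, ω x = σ x} := by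
  rw [localCondProb, integral_condExp (cylinderEvents_le_pi), integral_indicator
    (measurableSet_agree Λ σ)]
  simp

theorem localCondProb_nonneg (μ : Measure (Config d S)) (Λ : Finset (Site d))
    (σ : Config d S) : 0 ≤ᵐ[μ] localCondProb μ Λ σ :=
  condExp_nonneg (Eventually.of_forall fun _ => Set.indicator_nonneg (fun _ _ => zero_le_one) _)

/-- Integrating the conditional ratio bound removes the conditioning, provided the Boltzmann factor
is bounded uniformly in the exterior spins. -/
theorem IsGibbs.measureReal_le [DiscreteMeasurableSpace S] {β : ℝ}
    {U : Finset (Site d) → Config d S → ℝ} {μ : Measure (Config d S)} [IsProbabilityMeasure μ]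
    (hμ : IsGibbs β U μ) (Λ : Finset (Site d)) (σ η : Config d S) (c : ℝ)
    (hc : ∀ ξ, -β * relEnergy U (Λ.piecewise σ ξ) (Λ.piecewise η ξ) ≤ c) :
    μ.real {ω | ∀ x ∈ Λ, ω x = σ x} ≤ Real.exp c * μ.real {ω | ∀ x ∈ Λ, ω x = η x} := by
  rw [← integral_localCondProb, ← integral_localCondProb, ← integral_const_mul]
  refine integral_mono_ae integrable_condExp (integrable_condExp.const_mul _) ?_
  filter_upwards [hμ Λ σ η, localCondProb_nonneg μ Λ η] with ξ h1 h2
  -- Division by zero gives 0, which the positive Boltzmann factor excludes.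
  have hne : localCondProb μ Λ η ξ ≠ 0 := fun h => by
    rw [h, div_zero] at h1
    exact (Real.exp_pos _).ne h1
  rw [div_eq_iff hne] at h1
  rw [h1]
  exact mul_le_mul_of_nonneg_right (Real.exp_le_exp.2 (hc ξ)) h2

theorem integral_comp_restrict [Fintype S] [DiscreteMeasurableSpace S] (μ : Measure (Config d S))
    [IsProbabilityMeasure μ] (Λ : Finset (Site d)) (g : (Λ → S) → ℝ) :
    ∫ ω, g (Λ.restrict ω) ∂μ = ∑ τ, μ.real {ω | Λ.restrict ω = τ} * g τ := by
  have hm : Measurable (Λ.restrict : Config d S → Λ → S) := Finset.measurable_restrict Λ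
  rw [← integral_map (φ := Λ.restrict) hm.aemeasurable
    (measurable_of_finite g).aestronglyMeasurable]
  have := Measure.isProbabilityMeasure_map (μ := μ) hm.aemeasurable
  rw [integral_fintype (.of_finite)]
  refine Finset.sum_congr rfl fun τ _ => ?_
  rw [map_measureReal_apply hm (measurableSet_singleton τ), smul_eq_mul]
  rfl

end

theorem supSum_le_sum_add [Nonempty S] {h : Config d S → ℝ} {Λ : Finset (Site d)} {δ : ℝ}
    (hδ : ∀ ω ω' : Config d S, (∀ x ∈ Λ, ω x = ω' x) →
      |∑ x ∈ Λ, h (shift x ω) - ∑ x ∈ Λ, h (shift x ω')| ≤ δ) (ω : Config d S) :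
    supSum h Λ (Λ.restrict ω) ≤ ∑ x ∈ Λ, h (shift x ω) + δ :=
  supSum_le fun ω' hω' => by
    have := (abs_le.1 (hδ ω' ω (restrict_eq_restrict_iff.1 hω'))).2
    linarith

/-- Comparison of an exponential moment with a ratio of partition functions. -/
theorem abs_log_integral_exp_sub_le [Fintype S] [MeasurableSpace S] [DiscreteMeasurableSpace S]
    {β : ℝ} {U : Finset (Site d) → Config d S → ℝ} {μ : Measure (Config d S)}
    [IsProbabilityMeasure μ] (hμ : IsGibbs β U μ) {h G : Config d S → ℝ}
    (hh : IsQuasilocal h) (hG : IsQuasilocal G) {Λ : Finset (Site d)} {δ : ℝ}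
    (hδh : ∀ ω ω' : Config d S, (∀ x ∈ Λ, ω x = ω' x) →
      |∑ x ∈ Λ, h (shift x ω) - ∑ x ∈ Λ, h (shift x ω')| ≤ δ)
    (hδG : ∀ ω ω' : Config d S, (∀ x ∈ Λ, ω x = ω' x) →
      |∑ x ∈ Λ, G (shift x ω) - ∑ x ∈ Λ, G (shift x ω')| ≤ δ)
    (hrel : ∀ ω ω' : Config d S, (∀ x ∉ Λ, ω x = ω' x) → -β * relEnergy U ω ω' ≤
      ∑ x ∈ Λ, h (shift x ω) - ∑ x ∈ Λ, h (shift x ω') + δ) :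
    |Real.log (∫ ω, Real.exp (∑ x ∈ Λ, G (shift x ω)) ∂μ) -
      (Real.log (partitionFun (fun ω => h ω + G ω) Λ) - Real.log (partitionFun h Λ))| ≤
      4 * δ := by
  classical
  obtain ⟨ω₀⟩ : Nonempty (Config d S) := nonempty_of_isProbabilityMeasure μ
  have : Nonempty S := ⟨ω₀ 0⟩
  obtain ⟨Ch, hCh⟩ := hh.bounded
  obtain ⟨CG, hCG⟩ := hG.bounded
  obtain ⟨Cs, hCs⟩ := (hh.add hG).bounded
  have hδ0 : 0 ≤ δ := (abs_nonneg _).trans (hδh ω₀ ω₀ fun _ _ => rfl)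
  set P : (Λ → S) → ℝ := fun τ => μ.real {ω | Λ.restrict ω = τ} with hP
  have hP0 : ∀ τ, 0 ≤ P τ := fun τ => measureReal_nonneg
  have hP1 : ∑ τ, P τ = 1 := by
    have := integral_comp_restrict μ Λ fun _ => (1 : ℝ)
    simpa using this.symm
  set W := supSum h Λ with hW
  set V := supSum G Λ with hV
  set Y := supSum (fun ω => h ω + G ω) Λ with hY
  set Z := partitionFun h Λ with hZ
  have hZpos : 0 < Z := partitionFun_pos h Λ
  have hYpos : 0 < partitionFun (fun ω => h ω + G ω) Λ := partitionFun_pos _ Λ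
  -- One `δ` comes from the relative energy, the other from replacing the energy of the `τ'`
  -- configuration by its supremum.
  have hcomp : ∀ τ τ', P τ * Real.exp (W τ') ≤ Real.exp (W τ + 2 * δ) * P τ' := fun τ τ' => by
    obtain ⟨σ, rfl⟩ := restrict_surjective Λ τ
    obtain ⟨η, rfl⟩ := restrict_surjective Λ τ'
    have key := hμ.measureReal_le Λ σ η (W (Λ.restrict σ) - W (Λ.restrict η) + 2 * δ)
      fun ξ => by
      have h1 := hrel (Λ.piecewise σ ξ) (Λ.piecewise η ξ) fun x hx => by simp [hx]
      have hrσ : Λ.restrict (Λ.piecewise σ ξ) = Λ.restrict σ :=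
        restrict_eq_restrict_iff.2 fun x hx => by simp [hx]
      have hrη : Λ.restrict (Λ.piecewise η ξ) = Λ.restrict η :=
        restrict_eq_restrict_iff.2 fun x hx => by simp [hx]
      have h2 := le_supSum hCh Λ (Λ.piecewise σ ξ)
      have h3 := supSum_le_sum_add hδh (Λ.piecewise η ξ)
      rw [hrσ] at h2
      rw [hrη] at h3
      linarith
    simp only [hP, restrict_eq_restrict_iff]
    refine (mul_le_mul_of_nonneg_right key (Real.exp_pos _).le).trans (le_of_eq ?_)
    rw [mul_right_comm, ← Real.exp_add]
    congr 2
    ring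
  -- Summing the comparison over one index, with total mass 1, places `P τ` within `exp(±2δ)` of
  -- `exp (W τ) / Z`.
  have hPle : ∀ τ, P τ * Z ≤ Real.exp (W τ + 2 * δ) := fun τ => by
    have := Finset.sum_le_sum fun τ' (_ : τ' ∈ Finset.univ) => hcomp τ τ'
    rwa [← Finset.mul_sum, ← Finset.mul_sum, hP1, mul_one] at this
  have hPge : ∀ τ, Real.exp (W τ - 2 * δ) ≤ P τ * Z := fun τ => by
    have := Finset.sum_le_sum fun τ' (_ : τ' ∈ Finset.univ) => hcomp τ' τ
    rw [← Finset.sum_mul, ← Finset.sum_mul, hP1, one_mul] at this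
    simp only [Real.exp_add] at this
    rw [← Finset.sum_mul] at this
    rw [Real.exp_sub, div_le_iff₀ (Real.exp_pos _)]
    refine this.trans (le_of_eq ?_)
    rw [hZ, partitionFun]
    ring
  have hYle : ∀ τ, Y τ ≤ W τ + V τ := fun τ => supSum_le fun ω hω => by
    rw [Finset.sum_add_distrib, ← hω]
    exact add_le_add (le_supSum hCh Λ ω) (le_supSum hCG Λ ω)
  have hYge : ∀ τ, W τ + V τ - 2 * δ ≤ Y τ := fun τ => by
    obtain ⟨ω, rfl⟩ := restrict_surjective Λ τ
    have h1 := le_supSum hCs Λ ω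
    rw [Finset.sum_add_distrib] at h1
    have h2 := supSum_le_sum_add hδh ω
    have h3 := supSum_le_sum_add hδG ω
    linarith
  have hGm : Measurable fun ω : Config d S => ∑ x ∈ Λ, G (shift x ω) :=
    Finset.measurable_sum _ fun x _ => hG.measurable.comp
      (measurable_pi_lambda _ fun y => measurable_pi_apply (y + x))
  have hint : Integrable (fun ω => Real.exp (∑ x ∈ Λ, G (shift x ω))) μ := by
    refine Integrable.of_bound (Real.measurable_exp.comp hGm).aestronglyMeasurable
      (Real.exp (CG * Λ.card)) (Eventually.of_forall fun ω => ?_)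
    rw [Real.norm_eq_abs, Real.abs_exp, Real.exp_le_exp]
    exact (le_abs_self _).trans (abs_sum_shift_le hCG Λ ω)
  have hint' : ∀ g : (Λ → S) → ℝ, Integrable (fun ω => g (Λ.restrict ω)) μ := fun g => by
    refine Integrable.of_bound ((measurable_of_finite g).comp
      (Finset.measurable_restrict Λ)).aestronglyMeasurable (∑ τ, |g τ|)
      (Eventually.of_forall fun ω => ?_)
    exact Finset.single_le_sum (f := fun τ => |g τ|) (fun _ _ => abs_nonneg _)
      (Finset.mem_univ _)
  set I := ∫ ω, Real.exp (∑ x ∈ Λ, G (shift x ω)) ∂μ with hI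
  -- Of the `4δ`, two come from `P` and two from comparing `W + V` with `Y`.
  have hIle : I * Z ≤ Real.exp (4 * δ) * partitionFun (fun ω => h ω + G ω) Λ := by
    have h1 : I ≤ ∑ τ, P τ * Real.exp (V τ) := by
      rw [← integral_comp_restrict μ Λ fun τ => Real.exp (V τ)]
      exact integral_mono hint (hint' fun τ => Real.exp (V τ)) fun ω =>
        Real.exp_le_exp.2 (le_supSum hCG Λ ω)
    refine (mul_le_mul_of_nonneg_right h1 hZpos.le).trans ?_
    rw [Finset.sum_mul, partitionFun, Finset.mul_sum]
    refine Finset.sum_le_sum fun τ _ => ?_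
    rw [mul_right_comm]
    refine (mul_le_mul_of_nonneg_right (hPle τ) (Real.exp_pos _).le).trans ?_
    rw [← Real.exp_add, ← Real.exp_add, Real.exp_le_exp]
    have := hYge τ
    linarith
  have hIge : Real.exp (-(4 * δ)) * partitionFun (fun ω => h ω + G ω) Λ ≤ I * Z := by
    have h1 : ∑ τ, P τ * Real.exp (V τ - δ) ≤ I := by
      rw [← integral_comp_restrict μ Λ fun τ => Real.exp (V τ - δ)]
      refine integral_mono (hint' fun τ => Real.exp (V τ - δ)) hint fun ω =>
        Real.exp_le_exp.2 ?_
      have := supSum_le_sum_add hδG ω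
      linarith
    refine le_trans ?_ (mul_le_mul_of_nonneg_right h1 hZpos.le)
    rw [Finset.sum_mul, partitionFun, Finset.mul_sum]
    refine Finset.sum_le_sum fun τ _ => ?_
    rw [mul_right_comm]
    refine le_trans ?_ (mul_le_mul_of_nonneg_right (hPge τ) (Real.exp_pos _).le)
    rw [← Real.exp_add, ← Real.exp_add, Real.exp_le_exp]
    have := hYle τ
    linarith
  have hIpos : 0 < I := pos_of_mul_pos_left
    ((mul_pos (Real.exp_pos _) hYpos).trans_le hIge) hZpos.le
  have h1 := Real.log_le_log (mul_pos hIpos hZpos) hIle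
  have h2 := Real.log_le_log (mul_pos (Real.exp_pos _) hYpos) hIge
  rw [Real.log_mul hIpos.ne' hZpos.ne', Real.log_mul (Real.exp_pos _).ne' hYpos.ne',
    Real.log_exp] at h1 h2
  rw [abs_le]
  constructor <;> linarith

/-- The exponential moments of a quasilocal observable in a Gibbs state have a volume-normalized
logarithmic limit, the difference of two pressures. -/
theorem IsGibbs.tendsto_log_integral_exp [Fintype S] [MeasurableSpace S]
    [DiscreteMeasurableSpace S] {β : ℝ} {U : Finset (Site d) → Config d S → ℝ}
    (hU : IsPotential U) {μ : Measure (Config d S)} [IsProbabilityMeasure μ]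
    (hμ : IsGibbs β U μ) {G : Config d S → ℝ} (hG : IsQuasilocal G) :
    Tendsto (fun n : ℕ => Real.log (∫ ω, Real.exp (∑ x ∈ box d n, G (shift x ω)) ∂μ) /
      (box d n).card) atTop
      (𝓝 (pressure (fun ω => -β * siteEnergy U ω + G ω) -
        pressure fun ω => -β * siteEnergy U ω)) := by
  obtain ⟨ω₀⟩ : Nonempty (Config d S) := nonempty_of_isProbabilityMeasure μ
  have : Nonempty S := ⟨ω₀ 0⟩
  have hh := hU.isQuasilocal_siteEnergy.const_mul (-β)
  have hlim := (hh.add hG).tendsto_pressure.sub hh.tendsto_pressure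
  refine hlim.congr_dist ?_
  rw [Metric.tendsto_atTop']
  intro ε hε
  -- With `δ = (ε/8) |Λ_n|` the error `4δ` is half of what is allowed; the division by `|β| + 1`
  -- below absorbs the factor `β`, also when `β = 0`.
  have hε' : 0 < ε / 8 := by positivity
  have hev := ((hh.eventually_abs_sum_sub_le hε').and
    ((hG.eventually_abs_sum_sub_le hε').and
      (hU.eventually_abs_relEnergy_sub_le (show 0 < ε / 8 / (|β| + 1) by positivity))))
  obtain ⟨N, hN⟩ := eventually_atTop.1 hev
  refine ⟨N, fun n hn => ?_⟩
  obtain ⟨h1, h2, h3⟩ := hN n hn.le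
  have hp := card_box_pos (d := d) n
  have hmain := abs_log_integral_exp_sub_le hμ hh hG h1 h2 fun ω ω' hω => by
    have h4 := h3 ω ω' hω
    simp only [← Finset.mul_sum]
    set R := relEnergy U ω ω'
    set D := ∑ x ∈ box d n, siteEnergy U (shift x ω)
    set D' := ∑ x ∈ box d n, siteEnergy U (shift x ω')
    have h5 : -β * (R - (D - D')) ≤ |β| * |R - (D - D')| := by
      rw [← abs_neg β, ← abs_mul]
      exact le_abs_self _
    have h6 : |β| * |R - (D - D')| ≤ ε / 8 * (box d n).card := by
      refine (mul_le_mul_of_nonneg_left h4 (abs_nonneg β)).trans ?_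
      rw [← mul_assoc]
      refine mul_le_mul_of_nonneg_right ?_ hp.le
      rw [mul_div_assoc', div_le_iff₀ (by positivity)]
      nlinarith [abs_nonneg β]
    linarith
  rw [Real.dist_eq, sub_zero, abs_of_nonneg dist_nonneg, dist_comm, Real.dist_eq, ← sub_div,
    ← sub_div, abs_div, abs_of_pos hp, div_lt_iff₀ hp]
  refine hmain.trans_lt ?_
  nlinarith

end LatticeGibbs

end

/-! ### The symmetry of the generating function. -/

theorem theorem1 {d m : ℕ} {S : Type*} [Finite S] [MeasurableSpace S] [DiscreteMeasurableSpace S]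
    (π : ℕ → LatticeGibbs.Config d S → LatticeGibbs.Config d S)
    (hπ : LatticeGibbs.IsLocalInvolutionFamily π)
    (U₀ : Finset (LatticeGibbs.Site d) → LatticeGibbs.Config d S → ℝ)
    (U : Fin m → Finset (LatticeGibbs.Site d) → LatticeGibbs.Config d S → ℝ)
    (hU₀ : LatticeGibbs.IsPotential U₀) (hU : ∀ α, LatticeGibbs.IsPotential (U α))
    (hinv : ∀ A n, LatticeGibbs.boxIndex A ≤ n → ∀ σ, U₀ A (π n σ) = U₀ A σ)
    (β : ℝ) :
    (∀ α x, TendstoUniformly (LatticeGibbs.currentApprox π (U α) x)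
      (LatticeGibbs.current π (U α) x) atTop) ∧
    ∃ p : (Fin m → ℝ) → (Fin m → ℝ) → ℝ,
      (∀ (E : Fin m → ℝ) (μ : Measure (LatticeGibbs.Config d S)), IsProbabilityMeasure μ →
        LatticeGibbs.IsTranslationInvariant μ →
        LatticeGibbs.IsGibbs β (LatticeGibbs.totalPotential U₀ U E) μ →
        ∀ l : Fin m → ℝ,
          Tendsto
            (fun n : ℕ => -(1 / ((LatticeGibbs.box d n).card : ℝ) *
              Real.log (∫ σ, Real.exp (-β * ∑ x ∈ LatticeGibbs.box d n,
                ∑ α, l α * LatticeGibbs.current π (U α) x σ) ∂μ)))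
            atTop (𝓝 (p l E))) ∧
      ∀ l E : Fin m → ℝ, p l E = p (2 • E - l) E := by
  cases nonempty_fintype S
  obtain ⟨f, θ, hs, hF⟩ := hπ.exists_isSiteSymmetry_potential
  have hcur := fun α x σ => (hU α).current_eq (hF (U α) (hU α)) x σ
  refine ⟨fun α x => ?_, ?_⟩
  · rw [funext (hcur α x)]
    exact (hU α).tendstoUniformly_currentApprox (hF (U α) (hU α)) x
  let F : LatticeGibbs.Config d S → LatticeGibbs.Config d S := LatticeGibbs.siteMap f θ
  let e : Fin m → LatticeGibbs.Config d S → ℝ := fun α => LatticeGibbs.siteEnergy (U α)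
  let H : (Fin m → ℝ) → LatticeGibbs.Config d S → ℝ :=
    fun E ω => -β * LatticeGibbs.siteEnergy (LatticeGibbs.totalPotential U₀ U E) ω
  let G : (Fin m → ℝ) → LatticeGibbs.Config d S → ℝ :=
    fun l ω => -β * ∑ α, l α / 2 * (e α (F ω) + -1 * e α ω)
  have he₀ : ∀ ω, LatticeGibbs.siteEnergy U₀ (F ω) = LatticeGibbs.siteEnergy U₀ ω := fun ω => by
    simp only [LatticeGibbs.siteEnergy, F, ← hF U₀ hU₀, hinv _ _ le_rfl]
  have hG : ∀ l, LatticeGibbs.IsQuasilocal (G l) := fun l =>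
    (LatticeGibbs.IsQuasilocal.sum _ fun α _ =>
      ((hs.isQuasilocal_comp (hU α).isQuasilocal_siteEnergy).add
        ((hU α).isQuasilocal_siteEnergy.const_mul (-1))).const_mul (l α / 2)).const_mul (-β)
  -- The currents contain `e ∘ τ_x ∘ F` whereas `G` contains `e ∘ F ∘ τ_x`; the sums over a cube
  -- agree because `θ` permutes it.
  have hsum : ∀ l n σ, -β * ∑ x ∈ LatticeGibbs.box d n,
      ∑ α, l α * LatticeGibbs.current π (U α) x σ =
        ∑ x ∈ LatticeGibbs.box d n, G l (LatticeGibbs.shift x σ) := fun l n σ => by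
    simp only [G, hcur, ← Finset.mul_sum]
    congr 1
    rw [Finset.sum_comm, Finset.sum_comm (s := LatticeGibbs.box d n)]
    refine Finset.sum_congr rfl fun α _ => ?_
    rw [← Finset.mul_sum, ← Finset.mul_sum, ← Finset.sum_div, Finset.sum_sub_distrib,
      hs.sum_shift_siteMap, Finset.sum_add_distrib, ← Finset.mul_sum]
    ring
  refine ⟨fun l E => LatticeGibbs.pressure (H E) -
    LatticeGibbs.pressure (fun ω => H E ω + G l ω), fun E μ hμ _ hGibbs l => ?_, fun l E => ?_⟩
  · have h := (hGibbs.tendsto_log_integral_exp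
      (LatticeGibbs.isPotential_totalPotential hU₀ hU E) (hG l)).neg
    rw [neg_sub] at h
    refine h.congr fun n => ?_
    simp only [hsum]
    ring
  -- The coefficients of `e_α` and `e_α ∘ F` are `E_α - λ_α/2` and `λ_α/2`; both `λ ↦ 2E - λ` and
  -- composition with `F` exchange them.
  · have h : (fun ω => H E ω + G (2 • E - l) ω) = fun ω => H E (F ω) + G l (F ω) := by
      funext ω
      simp only [H, G, LatticeGibbs.siteEnergy_totalPotential hU₀ hU, he₀,
        show F (F ω) = ω from hs.siteMap_involutive ω]
      rw [← mul_add, ← mul_add, add_assoc, add_assoc, ← Finset.sum_add_distrib,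
        ← Finset.sum_add_distrib]
      congr 2
      refine Finset.sum_congr rfl fun α _ => ?_
      simp only [Pi.sub_apply, two_nsmul, Pi.add_apply, e]
      ring
    beta_reduce
    rw [h]
    exact congrArg _ (hs.pressure_comp fun ω => H E ω + G l ω).symm
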